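/- Let $\lambda=(\lambda_1\ge\lambda_2\ge\dots)$ be a partition with length $\ell=\ell(\lambda)$ and conjugate $\lambda^t$, let $n\ge\ell(\lambda)$ be any integer and put $h_i=\lambda_i-i+n$ for $1\le i\le n$. For ${\bf t}=(t_1,t_2,\dots)$, $t_m\in\mathbb C$, let $s_\lambda({\bf t})=\det\bigl(p_{\lambda_i-i+j}({\bf t})\bigr)_{1\le i,j\le\ell}$, where $\sum_{k\ge0}z^kp_k({\bf t})=\exp\sum_{m\ge1}z^mt_m$ and $p_k=0$ for $k<0$ (an empty determinant being $1$). Let $h_{ij}=\lambda_i-i+\lambda^t_j-j+1$ be the hook length of the node $(i,j)$ of the diagram of $\lambda$, and put $$H_\lambda=\prod_{(i,j)\in\lambda}h_{ij},\quad H_\lambda(q)=\prod_{(i,j)\in\lambda}(1-q^{h_{ij}}),\quad n(\lambda)=\sum_{i=1}^{\ell}(i-1)\lambda_i,$$ $$(a)_m=a(a+1)\cdots(a+m-1)=\frac{\Gamma(a+m)}{\Gamma(a)},\quad (q^a;q)_m=(1-q^a)\cdots(1-q^{a+m-1}),$$ $$(a)_\lambda=\prod_{i=1}^{\ell}(a-i+1)_{\lambda_i},\quad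 (q^a;q)_\lambda=\prod_{i=1}^{\ell}(q^{a-i+1};q)_{\lambda_i},$$ $$\Delta(h)=\prod_{1\le i<j\le n}(h_i-h_j),\quad \Delta(q^h)=\prod_{1\le i<j\le n}(q^{h_i}-q^{h_j}).$$ Let $a\in\mathbb C$, and let $q\in\mathbb C$ be nonzero and not a root of unity, with $q^x$ formed with the principal branch. Consider the times ${\bf t}_\infty=(1,0,0,\dots)$, ${\bf t}(a,1)=(\frac a1,\frac a2,\frac a3,\dots)$, ${\bf t}(\infty,q)$ with $t_m=\frac1{m(1-q^m)}$, and ${\bf t}(a,q)$ with $t_m=\frac{1-(q^a)^m}{m(1-q^m)}$, where $m\ge1$. Then $$s_\lambda({\bf t}_\infty)=\frac1{H_\lambda}=\frac{\Delta(h)}{\prod_{i=1}^nh_i!},$$ $$s_\lambda({\bf t}(a,1))=\frac{(a)_\lambda}{H_\lambda}=\frac{\Delta(h)}{\prod_{i=1}^nh_i!}\prod_{i=1}^n\frac{\Gamma(a-n+h_i+1)}{\Gamma(a-i+1)},$$ $$s_\lambda({\bf t}(\infty,q))=\frac{q^{n(\lambda)}}{H_\lambda(q)}=c_n(q)\,\frac{\Delta(q^h)}{\prod_{i=1}^n(q;q)_{h_i}},$$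 $$s_\lambda({\bf t}(a,q))=\frac{q^{n(\lambda)}(q^a;q)_\lambda}{H_\lambda(q)}=c_n(q)\,\frac{\Delta(q^h)}{\prod_{i=1}^n(q;q)_{h_i}}\prod_{i=1}^n(q^{a-i+1};q)_{h_i-n+i},$$ where $c_n(q)=(-1)^{\binom n2}q^{-\binom n3}$. In the second line the product of Gamma ratios is understood literally if no $\Gamma(a-i+1)$, $1\le i\le n$, has a pole, and as its limit (continuous extension in $a$) otherwise. The first equality for ${\bf t}(\infty,q)$ holds for $q=0$ as well. In particular, all the right-hand sides are independent of the choice of $n\ge\ell(\lambda)$. -/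

import Mathlib

open Filter Topology

/-! Partitions are Young diagrams: the parts are `λ_{i+1} = μ.rowLen i`, the parts of the conjugate
partition are `μ.colLen j`, the length is `ℓ(λ) = μ.colLen 0`. All indices start at `0` here.
A family of times is a function `t : ℕ → ℂ`, where `t m` is `t_m` for `m ≥ 1`; the value `t 0` is
never used. -/

namespace SchurSpec

noncomputable section

/-- The formal power series `∑_{m ≥ 1} t_m z^m`. -/
def timeSeries (t : ℕ → ℂ) : PowerSeries ℂ :=
  PowerSeries.mk fun m => if m = 0 then 0 else t m

/-- The elementary Schur functions: `∑_{k ≥ 0} z^k h_k(t) = exp (∑_{m ≥ 1} z^m t_m)`, and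
`h_k = 0` for `k < 0`. -/
def elemSchur (t : ℕ → ℂ) (k : ℤ) : ℂ :=
  if k < 0 then 0
  else PowerSeries.coeff k.toNat ((PowerSeries.exp ℂ).subst (timeSeries t))

/-- The Schur function `s_λ(t) = det (h_{λ_i - i + j}(t))_{1 ≤ i, j ≤ ℓ(λ)}`. -/
def schur (μ : YoungDiagram) (t : ℕ → ℂ) : ℂ :=
  Matrix.det (Matrix.of fun i j : Fin (μ.colLen 0) =>
    elemSchur t ((μ.rowLen i : ℤ) - (i : ℤ) + (j : ℤ)))

/-- The hook length `λ_i - i + λᵗ_j - j + 1` (with `i, j ≥ 1`) of a cell, in `0`-based indices.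
The subtraction does not truncate when the cell lies in the diagram. -/
def hookLength (μ : YoungDiagram) (c : ℕ × ℕ) : ℕ :=
  μ.rowLen c.1 + μ.colLen c.2 - (c.1 + c.2 + 1)

/-- The product of hook lengths `H_λ`. -/
def hookProd (μ : YoungDiagram) : ℕ := ∏ c ∈ μ.cells, hookLength μ c

/-- The hook polynomial `H_λ(q)`. -/
def hookPoly (μ : YoungDiagram) (q : ℂ) : ℂ := ∏ c ∈ μ.cells, (1 - q ^ hookLength μ c)

/-- `n(λ) = ∑_i (i - 1) λ_i` (with `i ≥ 1`). -/
def nStat (μ : YoungDiagram) : ℕ := ∑ i ∈ Finset.range (μ.colLen 0), i * μ.rowLen i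

/-- `(a)_m = a (a + 1) ⋯ (a + m - 1)`, which is `Γ(a + m) / Γ(a)` wherever the latter is
defined (see `Complex.Gamma_add_nat_div_Gamma_eq`). -/
def poch (a : ℂ) (m : ℕ) : ℂ := (ascPochhammer ℂ m).eval a

/-- `(a)_λ = (a)_{λ_1} (a - 1)_{λ_2} ⋯ (a - ℓ + 1)_{λ_ℓ}`. -/
def pochPartition (a : ℂ) (μ : YoungDiagram) : ℂ :=
  ∏ i ∈ Finset.range (μ.colLen 0), poch (a - i) (μ.rowLen i)

/-- `(q^a; q)_m = (1 - q^a) (1 - q^{a+1}) ⋯ (1 - q^{a+m-1})`. -/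
def qPoch (q a : ℂ) (m : ℕ) : ℂ := ∏ j ∈ Finset.range m, (1 - q ^ (a + j))

/-- `(q^a; q)_λ = (q^a; q)_{λ_1} (q^{a-1}; q)_{λ_2} ⋯ (q^{a-ℓ+1}; q)_{λ_ℓ}`. -/
def qPochPartition (q a : ℂ) (μ : YoungDiagram) : ℂ :=
  ∏ i ∈ Finset.range (μ.colLen 0), qPoch q (a - i) (μ.rowLen i)

/-- The times `t_∞ = (1, 0, 0, …)`. -/
def tInf : ℕ → ℂ := fun m => if m = 1 then 1 else 0

/-- The times `t(a, 1) = (a / 1, a / 2, a / 3, …)`. -/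
def tA (a : ℂ) : ℕ → ℂ := fun m => a / m

/-- The times `t_m(∞, q) = 1 / (m (1 - q^m))`. -/
def tInfQ (q : ℂ) : ℕ → ℂ := fun m => 1 / (m * (1 - q ^ m))

/-- The times `t_m(a, q) = (1 - (q^a)^m) / (m (1 - q^m))`. -/
def tAQ (a q : ℂ) : ℕ → ℂ := fun m => (1 - (q ^ a) ^ m) / (m * (1 - q ^ m))

/-- The shifted parts `h_i = λ_i - i + n`, `1 ≤ i ≤ n`, in `0`-based indices. -/
def shiftedPart (μ : YoungDiagram) (n : ℕ) (i : Fin n) : ℕ := μ.rowLen i + (n - 1 - i)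

/-- The Vandermonde product `Δ(x) = ∏_{i < j} (x_i - x_j)`. -/
def vdm {n : ℕ} (x : Fin n → ℂ) : ℂ := ∏ i, ∏ j ∈ Finset.Ioi i, (x i - x j)

/-- `Δ(h) / ∏_i h_i!`. -/
def vdmRatio (μ : YoungDiagram) (n : ℕ) : ℂ :=
  vdm (fun i => (shiftedPart μ n i : ℂ)) / ∏ i, ((shiftedPart μ n i).factorial : ℂ)

/-- `Δ(q^h) / ∏_i (q; q)_{h_i}`. -/
def qVdmRatio (μ : YoungDiagram) (n : ℕ) (q : ℂ) : ℂ :=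
  vdm (fun i => q ^ shiftedPart μ n i) / ∏ i, qPoch q 1 (shiftedPart μ n i)

/-- `∏_{i=1}^n Γ(a - n + h_i + 1) / Γ(a - i + 1)`. -/
def gammaRatio (μ : YoungDiagram) (n : ℕ) (a : ℂ) : ℂ :=
  ∏ i : Fin n, Complex.Gamma (a - n + shiftedPart μ n i + 1) / Complex.Gamma (a - i)

end

end SchurSpec

/-! ### Generating series and the recurrences for the elementary Schur functions. -/

namespace SchurSpec

open PowerSeries

/-! Each family of times makes the generating series solve a differential or `q`-difference
equation, which says `p_{k+1} b(k+1) = p_k f(k)`; hence `p_k = f(0)⋯f(k-1) / (b(1)⋯b(k))`, with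
`b(k) = k` or `1 - q^k`.

Two identities then evaluate the determinant uniformly. From `f(k-r) = f(-r-1) + c_r b(k+1)`, column
operations extract the product of `f` over the contents of the cells and leave the determinant for
`f = 1` (`det_factorialRatio`). From `b(h-s) = u_s (x_h - x_s)`, what remains is a Vandermonde
determinant (`det_factorialRatio_one`).

The hook form is combinatorial: the hooks of row `i` together with the differences `h_i - h_j`, `j >
i`, exhaust `1, …, h_i` (`row_hooks_union`). So the Vandermonde quotient is a reciprocal hook
product up to powers of `u`, for every `n ≥ ℓ(λ)`; this also gives independence of `n`. Poles of
Gamma and the value `q = 0` are reached by continuity. -/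

lemma powerSeries_eq_zero_of_derivative_eq_mul {F W : PowerSeries ℂ}
    (h : derivative ℂ F = W * F) (h0 : coeff 0 F = 0) : F = 0 := by
  ext n
  induction n using Nat.strong_induction_on with
  | _ n ih =>
    cases n with
    | zero => simpa using h0
    | succ n =>
      have h1 := congrArg (coeff n) h
      rw [coeff_derivative, coeff_mul, Finset.sum_eq_zero] at h1
      · have : ((n : ℂ) + 1) ≠ 0 := by exact_mod_cast Nat.succ_ne_zero n
        simpa [this] using h1
      · intro x hx
        rw [ih x.2 (by have := Finset.HasAntidiagonal.mem_antidiagonal.1 hx; omega)]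
        simp

lemma powerSeries_eq_of_derivative_eq_mul {F G W : PowerSeries ℂ}
    (hF : derivative ℂ F = W * F) (hG : derivative ℂ G = W * G) (h0 : coeff 0 F = coeff 0 G) :
    F = G := by
  refine sub_eq_zero.1 (powerSeries_eq_zero_of_derivative_eq_mul (W := W) ?_ ?_)
  · rw [map_sub, hF, hG, mul_sub]
  · rw [map_sub, h0, sub_self]

lemma hasSubst_timeSeries (t : ℕ → ℂ) : HasSubst (timeSeries t) :=
  HasSubst.of_constantCoeff_zero' (by
    rw [← coeff_zero_eq_constantCoeff_apply]; simp [timeSeries])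

/-- The generating function of the elementary Schur functions. -/
noncomputable def schurSeries (t : ℕ → ℂ) : PowerSeries ℂ := (exp ℂ).subst (timeSeries t)

lemma elemSchur_natCast (t : ℕ → ℂ) (k : ℕ) : elemSchur t k = coeff k (schurSeries t) := by
  simp [elemSchur, schurSeries]

lemma derivative_schurSeries (t : ℕ → ℂ) :
    derivative ℂ (schurSeries t) = derivative ℂ (timeSeries t) * schurSeries t := by
  rw [schurSeries, derivative_subst (hasSubst_timeSeries t), derivative_exp, mul_comm]

lemma coeff_zero_schurSeries (t : ℕ → ℂ) : coeff 0 (schurSeries t) = 1 := by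
  rw [schurSeries, coeff_subst' (hasSubst_timeSeries t), finsum_eq_single _ 0]
  · simp
  · intro d hd
    rw [coeff_zero_eq_constantCoeff_apply, map_pow, ← coeff_zero_eq_constantCoeff_apply]
    simp [timeSeries, hd]

lemma coeff_derivative_timeSeries (t : ℕ → ℂ) (n : ℕ) :
    coeff n (derivative ℂ (timeSeries t)) = t (n + 1) * (n + 1) := by
  rw [coeff_derivative]; simp [timeSeries]

lemma elemSchur_zero (t : ℕ → ℂ) : elemSchur t 0 = 1 := by
  have := elemSchur_natCast t 0
  rw [coeff_zero_schurSeries] at this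
  exact_mod_cast this

lemma elemSchur_of_neg (t : ℕ → ℂ) {k : ℤ} (hk : k < 0) : elemSchur t k = 0 := by
  simp [elemSchur, hk]

lemma elemSchur_tInf_succ (k : ℕ) :
    elemSchur tInf (k + 1 : ℕ) * (k + 1) = elemSchur tInf k := by
  have hT : derivative ℂ (timeSeries tInf) = 1 := by
    ext n
    rw [coeff_derivative_timeSeries, coeff_one]
    by_cases h : n = 0 <;> simp [tInf, h]
  have h := congrArg (coeff k) (derivative_schurSeries tInf)
  rw [hT, one_mul, coeff_derivative] at h
  rw [elemSchur_natCast, elemSchur_natCast, h]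

/-- The geometric series `∑ c^m z^m`. -/
noncomputable def geomSeries (c : ℂ) : PowerSeries ℂ := PowerSeries.mk fun n => c ^ n

lemma one_sub_mul_geomSeries (c : ℂ) : (1 - C c * X) * geomSeries c = 1 := by
  ext n
  rw [sub_mul, one_mul, mul_assoc, map_sub, coeff_C_mul]
  cases n with
  | zero => simp [geomSeries]
  | succ n => rw [coeff_succ_X_mul]; simp [geomSeries, pow_succ', coeff_one]

lemma coeff_one_sub_mul (c : ℂ) (F : PowerSeries ℂ) (k : ℕ) :
    coeff (k + 1) ((1 - C c * X) * F) = coeff (k + 1) F - c * coeff k F := by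
  rw [sub_mul, one_mul, mul_assoc, map_sub, coeff_C_mul, coeff_succ_X_mul]

/-- Here `T' = a/(1-z)`, so `(1-z)E' = aE`; compare coefficients of `z^k`. -/
lemma elemSchur_tA_succ (a : ℂ) (k : ℕ) :
    elemSchur (tA a) (k + 1 : ℕ) * (k + 1) = elemSchur (tA a) k * (a + k) := by
  have hT : derivative ℂ (timeSeries (tA a)) = C a * geomSeries 1 := by
    ext n
    rw [coeff_derivative_timeSeries, coeff_C_mul]
    have : ((n : ℂ) + 1) ≠ 0 := by exact_mod_cast Nat.succ_ne_zero n
    simp [tA, geomSeries, this]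
  have h : (1 - C 1 * X) * derivative ℂ (schurSeries (tA a)) = C a * schurSeries (tA a) := by
    rw [derivative_schurSeries, hT]
    linear_combination (C a * schurSeries (tA a)) * one_sub_mul_geomSeries 1
  rw [elemSchur_natCast, elemSchur_natCast]
  cases k with
  | zero =>
    have h := congrArg (coeff 0) h
    rw [coeff_C_mul] at h
    have h2 : coeff 0 ((1 - C 1 * X) * derivative ℂ (schurSeries (tA a)))
        = coeff 0 (derivative ℂ (schurSeries (tA a))) := by
      simp
    rw [h2, coeff_derivative] at h
    simpa [mul_comm] using h
  | succ k =>
    have h := congrArg (coeff (k + 1)) h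
    rw [coeff_C_mul, coeff_one_sub_mul, coeff_derivative, coeff_derivative] at h
    push_cast at h ⊢
    linear_combination h

lemma derivative_rescale (c : ℂ) (F : PowerSeries ℂ) :
    derivative ℂ (rescale c F) = C c * rescale c (derivative ℂ F) := by
  ext n
  rw [coeff_derivative, coeff_rescale, coeff_C_mul, coeff_rescale, coeff_derivative]
  ring

/-- The source is the `q`-difference equation `(1-z)E(z) = (1-Az)E(qz)`. Both sides have constant
term `1` and the same logarithmic derivative, because `V = T'` satisfies `V(z) - qV(qz) = 1/(1-z) -
A/(1-Az)`. -/
lemma elemSchur_qTimes_succ {A q : ℂ} {t : ℕ → ℂ}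
    (ht : ∀ m : ℕ, t (m + 1) * (m + 1) * (1 - q ^ (m + 1)) = 1 - A ^ (m + 1)) (k : ℕ) :
    elemSchur t (k + 1 : ℕ) * (1 - q ^ (k + 1)) = elemSchur t k * (1 - A * q ^ k) := by
  set E := schurSeries t with hE
  set V := derivative ℂ (timeSeries t) with hV
  have hV' : V - C q * rescale q V = geomSeries 1 - C A * geomSeries A := by
    ext n
    rw [map_sub, map_sub, coeff_C_mul, coeff_C_mul, coeff_rescale, hV,
      coeff_derivative_timeSeries]
    simp only [geomSeries, coeff_mk, one_pow]
    linear_combination ht n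
  have hE' : derivative ℂ E = V * E := derivative_schurSeries t
  have key : (1 - C 1 * X) * E = (1 - C A * X) * rescale q E := by
    refine powerSeries_eq_of_derivative_eq_mul (W := V - geomSeries 1) ?_ ?_ ?_
    · rw [Derivation.leibniz, hE']
      simp only [smul_eq_mul, map_sub, Derivation.leibniz, derivative_X, derivative_C,
        derivative_one]
      have := one_sub_mul_geomSeries 1
      simp only [map_one] at *
      linear_combination E * this
    · rw [Derivation.leibniz, derivative_rescale, hE', map_mul]
      simp only [smul_eq_mul, map_sub, Derivation.leibniz, derivative_X, derivative_C,
        derivative_one]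
      linear_combination C A * rescale q E * one_sub_mul_geomSeries A
        - (1 - C A * X) * rescale q E * hV'
    · have h1 : ∀ (c : ℂ) (F : PowerSeries ℂ), coeff 0 ((1 - C c * X) * F) = coeff 0 F := by simp
      rw [h1, h1, coeff_rescale, pow_zero, one_mul]
  have h := congrArg (coeff (k + 1)) key
  rw [coeff_one_sub_mul, coeff_one_sub_mul, coeff_rescale, coeff_rescale] at h
  rw [elemSchur_natCast, elemSchur_natCast]
  linear_combination h

end SchurSpec

/-! ### Evaluation of the determinant. -/

namespace SchurSpec

open Finset Matrix

lemma det_of_column_shift {n : ℕ} (P : ℕ → ℤ → ℂ) (c : ℕ → ℂ)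
    (hP : ∀ r k, P (r + 1) k = P r k - c r * P r (k - 1)) (l : Fin n → ℤ) :
    det (of fun i j : Fin n => P 0 (l i + j)) = det (of fun i j : Fin n => P j (l i + j)) := by
  cases n with
  | zero => simp
  | succ n =>
    -- Pass `r` subtracts `c r` times the preceding column from each column beyond the `r`-th, so
    -- column `j` changes exactly `j` times.
    have key : ∀ r : ℕ, det (of fun i j : Fin (n + 1) => P 0 (l i + j))
        = det (of fun i j : Fin (n + 1) => P (min r j) (l i + j)) := by
      intro r
      induction r with
      | zero => simp
      | succ r ih =>
        rw [ih]
        refine det_eq_of_forall_col_eq_smul_add_pred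
          (fun j => if r ≤ (j : ℕ) then c r else 0) (fun i => by simp) fun i j => ?_
        simp only [of_apply, Fin.val_succ, Fin.val_castSucc]
        split_ifs with hj
        · rw [min_eq_left (by omega : r ≤ (j : ℕ) + 1),
            min_eq_left (by omega : r + 1 ≤ (j : ℕ) + 1), min_eq_left hj, hP]
          push_cast
          rw [show l i + ((j : ℤ) + 1) - 1 = l i + j by ring]
          ring
        · rw [min_eq_right (by omega : (j : ℕ) + 1 ≤ r),
            min_eq_right (by omega : (j : ℕ) + 1 ≤ r + 1)]
          ring
    rw [key (n + 1)]
    congr 1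
    ext i j
    simp

/-- The factorial `b 1 * b 2 * ⋯ * b k` of a sequence of numbers. -/
noncomputable def bFactorial (b : ℕ → ℂ) (k : ℕ) : ℂ := ∏ s ∈ range k, b (s + 1)

lemma bFactorial_succ (b : ℕ → ℂ) (k : ℕ) : bFactorial b (k + 1) = bFactorial b k * b (k + 1) :=
  prod_range_succ _ _

lemma bFactorial_ne_zero {b : ℕ → ℂ} (hb : ∀ k, b (k + 1) ≠ 0) (k : ℕ) : bFactorial b k ≠ 0 :=
  prod_ne_zero_iff.2 fun s _ => hb s

/-- The ratio `f (-r) * f (1 - r) * ⋯ * f (k - 1 - r) / (b 1 * ⋯ * b k)`, zero for `k < 0`. -/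
noncomputable def factorialRatio (f : ℤ → ℂ) (b : ℕ → ℂ) (r : ℕ) (k : ℤ) : ℂ :=
  if k < 0 then 0 else (∏ s ∈ range k.toNat, f (s - r)) / bFactorial b k.toNat

lemma factorialRatio_natCast (f : ℤ → ℂ) (b : ℕ → ℂ) (r k : ℕ) :
    factorialRatio f b r k = (∏ s ∈ range k, f (s - r)) / bFactorial b k := by
  simp [factorialRatio]

lemma factorialRatio_of_neg (f : ℤ → ℂ) (b : ℕ → ℂ) (r : ℕ) {k : ℤ} (hk : k < 0) :
    factorialRatio f b r k = 0 := by
  simp [factorialRatio, hk]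

lemma factorialRatio_succ_left {f : ℤ → ℂ} {b c : ℕ → ℂ} (hb : ∀ k, b (k + 1) ≠ 0)
    (hf : ∀ r k : ℕ, f (k - r) = f (-r - 1) + c r * b (k + 1)) (r : ℕ) (k : ℤ) :
    factorialRatio f b (r + 1) k = factorialRatio f b r k - c r * factorialRatio f b r (k - 1) := by
  rcases lt_or_ge k 0 with hk | hk
  · rw [factorialRatio_of_neg _ _ _ hk, factorialRatio_of_neg _ _ _ hk,
      factorialRatio_of_neg _ _ _ (by omega)]
    simp
  · lift k to ℕ using hk
    cases k with
    | zero =>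
      rw [factorialRatio_of_neg _ _ _ (by simp : ((0 : ℕ) : ℤ) - 1 < 0), factorialRatio_natCast,
        factorialRatio_natCast]
      simp
    | succ k =>
      rw [show ((k + 1 : ℕ) : ℤ) - 1 = k by push_cast; ring, factorialRatio_natCast,
        factorialRatio_natCast, factorialRatio_natCast, prod_range_succ', prod_range_succ,
        bFactorial_succ, hf r k]
      have h1 := bFactorial_ne_zero hb k
      have h2 := hb k
      have h3 : ∏ x ∈ range k, f (((x + 1 : ℕ) : ℤ) - ((r + 1 : ℕ) : ℤ))
          = ∏ x ∈ range k, f (x - r) := by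
        refine prod_congr rfl fun x _ => ?_
        congr 1
        push_cast
        ring
      rw [h3, show ((0 : ℕ) : ℤ) - ((r + 1 : ℕ) : ℤ) = -r - 1 by push_cast; ring]
      field_simp
      ring

/-- After the column operations the numerator in entry `(i, j)` is `f(-j)⋯f(λ_i-i-1)`. Multiplying
column `j` by `g j = f(-(n-1))⋯f(-j-1)` makes it depend on the row alone, and it equals `g i` times
the content product of row `i`. The factors `g` cancel, being nonzero. -/
lemma det_factorialRatio_of_ne_zero {n : ℕ} {f : ℤ → ℂ} {b c : ℕ → ℂ}
    (hb : ∀ k, b (k + 1) ≠ 0) (hf : ∀ r k : ℕ, f (k - r) = f (-r - 1) + c r * b (k + 1))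
    (hf0 : ∀ s ∈ range n, f (s - (n - 1 : ℕ)) ≠ 0) (lam : Fin n → ℕ) :
    det (of fun i j : Fin n => factorialRatio f b 0 ((lam i : ℤ) - (i : ℤ) + (j : ℤ)))
      = (∏ i, ∏ s ∈ range (lam i), f (s - (i : ℕ)))
        * det (of fun i j : Fin n =>
            factorialRatio (fun _ => 1) b 0 ((lam i : ℤ) - (i : ℤ) + (j : ℤ))) := by
  rw [det_of_column_shift (factorialRatio f b) c (factorialRatio_succ_left hb hf)]
  set g : Fin n → ℂ := fun j => ∏ s ∈ range (n - 1 - j), f (s - (n - 1 : ℕ)) with hg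
  have hg0 : ∏ j, g j ≠ 0 := prod_ne_zero_iff.2 fun j _ => prod_ne_zero_iff.2 fun s hs =>
    hf0 s (mem_range.2 (by have := mem_range.1 hs; omega))
  have hsplit : ∀ (j : Fin n) (k : ℕ), g j * ∏ s ∈ range k, f (s - (j : ℕ))
      = ∏ s ∈ range (n - 1 - j + k), f (s - (n - 1 : ℕ)) := by
    intro j k
    rw [prod_range_add]
    congr 1
    refine prod_congr rfl fun s _ => ?_
    congr 1
    omega
  refine mul_left_cancel₀ hg0 ?_
  rw [← det_mul_row, ← mul_assoc, ← prod_mul_distrib, ← det_mul_column]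
  congr 1
  ext i j
  simp only [of_apply]
  rw [hsplit]
  rcases lt_or_ge ((lam i : ℤ) - (i : ℤ) + (j : ℤ)) 0 with hk | hk
  · simp [factorialRatio_of_neg _ _ _ hk]
  · obtain ⟨k, hk'⟩ := Int.eq_ofNat_of_zero_le hk
    rw [hk', factorialRatio_natCast, factorialRatio_natCast, ← mul_div_assoc, hsplit,
      prod_const_one, mul_one_div]
    congr 3
    omega

lemma det_factorialRatio {n : ℕ} {f : ℤ → ℂ} {b c : ℕ → ℂ}
    (hb : ∀ k, b (k + 1) ≠ 0) (hf : ∀ r k : ℕ, f (k - r) = f (-r - 1) + c r * b (k + 1))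
    (lam : Fin n → ℕ) :
    det (of fun i j : Fin n => factorialRatio f b 0 ((lam i : ℤ) - (i : ℤ) + (j : ℤ)))
      = (∏ i, ∏ s ∈ range (lam i), f (s - (i : ℕ)))
        * det (of fun i j : Fin n =>
            factorialRatio (fun _ => 1) b 0 ((lam i : ℤ) - (i : ℤ) + (j : ℤ))) := by
  -- Replacing `f` by `f + e` preserves `hf` with the same `b` and `c`; outside the finite set `S`
  -- of shifts `e` nothing vanishes, and density reaches `e = 0`.
  set S : Finset ℂ := (range n).image fun s : ℕ => -f (s - (n - 1 : ℕ))
  have hS : Dense ((S : Set ℂ)ᶜ) := S.finite_toSet.countable.dense_compl ℝ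
  have hcont : ∀ k : ℤ, Continuous fun e : ℂ => factorialRatio (fun s => f s + e) b 0 k := by
    intro k
    unfold factorialRatio
    split_ifs
    · exact continuous_const
    · exact (continuous_finsetProd _ fun s _ => by fun_prop).div_const _
  have h := Continuous.ext_on (f := fun e : ℂ => det (of fun i j : Fin n =>
      factorialRatio (fun s => f s + e) b 0 ((lam i : ℤ) - (i : ℤ) + (j : ℤ))))
    (g := fun e : ℂ => (∏ i, ∏ s ∈ range (lam i), (f (s - (i : ℕ)) + e))
        * det (of fun i j : Fin n =>
            factorialRatio (fun _ => 1) b 0 ((lam i : ℤ) - (i : ℤ) + (j : ℤ)))) hS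
    (Continuous.matrix_det (continuous_matrix fun i j => hcont _)) (by fun_prop) fun e he =>
      det_factorialRatio_of_ne_zero (c := c) hb (fun r k => by rw [hf r k]; ring) (fun s hs h0 =>
        he (mem_coe.2 (mem_image.2 ⟨s, hs, by linear_combination -h0⟩))) lam
  simpa using congrFun h 0

lemma factorialRatio_one_sub {b x u : ℕ → ℂ} (hb : ∀ k, b (k + 1) ≠ 0)
    (hx : ∀ s h, s < h → b (h - s) = u s * (x h - x s)) (h m : ℕ) :
    factorialRatio (fun _ => 1) b 0 ((h : ℤ) - m)
      = (∏ s ∈ range m, u s) * (∏ s ∈ range m, (x h - x s)) / bFactorial b h := by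
  rcases lt_or_ge h m with hm | hm
  -- The factor at `s = h` vanishes, in agreement with the convention for negative indices.
  · rw [factorialRatio_of_neg _ _ _ (by omega), prod_eq_zero (f := fun s => x h - x s)
      (mem_range.2 hm) (sub_self _)]
    simp
  · rw [← prod_mul_distrib, ← Nat.cast_sub hm, factorialRatio_natCast, prod_const_one,
      div_eq_div_iff (bFactorial_ne_zero hb _) (bFactorial_ne_zero hb _), one_mul]
    induction m with
    | zero => simp
    | succ m ih =>
      rw [ih (by omega), prod_range_succ, ← hx m h (by omega),
        show h - m = h - (m + 1) + 1 by omega, bFactorial_succ]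
      ring

lemma vdm_eq_det_vandermonde {n : ℕ} (x : Fin n → ℂ) :
    vdm x = det (vandermonde fun i => x i.rev) := by
  rw [det_vandermonde, vdm, prod_sigma', prod_sigma']
  refine prod_bij' (fun p _ => ⟨p.2.rev, p.1.rev⟩) (fun p _ => ⟨p.2.rev, p.1.rev⟩) ?_ ?_ ?_ ?_ ?_
    <;> simp

lemma det_factorialRatio_one {n : ℕ} {b x u : ℕ → ℂ} (hb : ∀ k, b (k + 1) ≠ 0)
    (hx : ∀ s h, s < h → b (h - s) = u s * (x h - x s)) (h : Fin n → ℕ) :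
    det (of fun i j : Fin n => factorialRatio (fun _ => 1) b 0 ((h i : ℤ) - ((n - 1 - j : ℕ) : ℤ)))
      = (∏ m ∈ range n, ∏ s ∈ range m, u s) * vdm (fun i => x (h i))
        / ∏ i, bFactorial b (h i) := by
  have hE : (of fun i j : Fin n =>
        factorialRatio (fun _ => 1) b 0 ((h i : ℤ) - ((n - 1 - j : ℕ) : ℤ)))
      = of fun i j : Fin n => (bFactorial b (h i))⁻¹ * (of fun i j : Fin n =>
          (∏ s ∈ range (n - 1 - j), u s) * (of fun i j : Fin n =>
            ∏ s ∈ range (n - 1 - j), (x (h i) - x s)) i j) i j := by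
    ext i j
    simp only [of_apply]
    rw [factorialRatio_one_sub hb hx]
    ring
  rw [hE, det_mul_column, det_mul_row]
  have hu : ∏ j : Fin n, ∏ s ∈ range (n - 1 - j), u s = ∏ m ∈ range n, ∏ s ∈ range m, u s := by
    rw [← Fin.prod_univ_eq_prod_range fun m => ∏ s ∈ range m, u s]
    refine Fintype.prod_equiv Fin.revPerm _ _ fun j => ?_
    rw [Fin.revPerm_apply, Fin.val_rev, show n - ((j : ℕ) + 1) = n - 1 - j by omega]
  have hv : det (of fun i j : Fin n => ∏ s ∈ range (n - 1 - j), (x (h i) - x s))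
      = vdm fun i => x (h i) := by
    -- The columns are monic polynomials of degrees `n-1, …, 0` evaluated at `x (h i)`; the reversal
    -- accounts for the decreasing degrees.
    rw [vdm_eq_det_vandermonde, det_eval_matrixOfPolynomials_eq_det_vandermonde _
      (fun j : Fin n => ∏ s ∈ range j, (Polynomial.X - Polynomial.C (x s)))
      (fun j => by rw [Polynomial.natDegree_finsetProd_X_sub_C_eq_card, card_range])
      (fun j => Polynomial.monic_prod_X_sub_C _ _), ← det_submatrix_equiv_self Fin.revPerm]
    congr 1
    ext i j
    simp only [submatrix_apply, of_apply, Fin.revPerm_apply, Polynomial.eval_prod, Fin.val_rev,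
      Polynomial.eval_sub, Polynomial.eval_X, Polynomial.eval_C]
    refine prod_congr ?_ fun _ _ => rfl
    congr 1
    omega
  rw [hu, hv, prod_inv_distrib]
  ring

end SchurSpec

/-! ### Hook lengths and the Vandermonde quotient. -/

namespace SchurSpec

open Finset

section Hooks

variable {μ : YoungDiagram} {n : ℕ}

lemma hookLength_pos {c : ℕ × ℕ} (hc : c ∈ μ.cells) : 0 < hookLength μ c := by
  have h1 : c.2 < μ.rowLen c.1 := YoungDiagram.mem_iff_lt_rowLen.1 ((YoungDiagram.mem_cells _).1 hc)
  have h2 : c.1 < μ.colLen c.2 := YoungDiagram.mem_iff_lt_colLen.1 ((YoungDiagram.mem_cells _).1 hc)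
  unfold hookLength
  omega

lemma rowLen_eq_zero {i : ℕ} (hi : μ.colLen 0 ≤ i) : μ.rowLen i = 0 := by
  by_contra h
  have h1 : (i, 0) ∈ μ := YoungDiagram.mem_iff_lt_rowLen.2 (Nat.pos_of_ne_zero h)
  have := YoungDiagram.mem_iff_lt_colLen.1 h1
  omega

lemma lt_colLen_iff (μ : YoungDiagram) (i c : ℕ) : i < μ.colLen c ↔ c < μ.rowLen i := by
  rw [← YoungDiagram.mem_iff_lt_colLen, YoungDiagram.mem_iff_lt_rowLen]

lemma shiftedPart_strictAnti : StrictAnti (shiftedPart μ n) := by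
  intro i j hij
  have := μ.rowLen_anti i j (by exact_mod_cast hij.le)
  have h : (i : ℕ) < j := hij
  unfold shiftedPart
  omega

/-- The hook lengths in row `i` and the differences `h_i - h_j`, `j > i`, together are
`1, 2, …, h_i`. -/
lemma row_hooks_union (hn : μ.colLen 0 ≤ n) (i : Fin n) :
    (range (μ.rowLen i)).image (fun c => hookLength μ (i, c)) ∪
      (Ioi i).image (fun j => shiftedPart μ n i - shiftedPart μ n j)
      = Icc 1 (shiftedPart μ n i) ∧
    Disjoint ((range (μ.rowLen i)).image fun c => hookLength μ (i, c))
      ((Ioi i).image fun j => shiftedPart μ n i - shiftedPart μ n j) ∧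
    Set.InjOn (fun c => hookLength μ (i, c)) (range (μ.rowLen i)) ∧
    Set.InjOn (fun j => shiftedPart μ n i - shiftedPart μ n j) (Ioi i : Finset (Fin n)) := by
  have hcol : ∀ c, μ.colLen c ≤ n := fun c => (μ.colLen_anti 0 c (Nat.zero_le c)).trans hn
  have hinj1 : Set.InjOn (fun c => hookLength μ (i, c)) (range (μ.rowLen i)) := by
    have hlt : ∀ c d, c < d → d < μ.rowLen i → hookLength μ (i, d) < hookLength μ (i, c) := by
      intro c d hcd hd
      have h1 := μ.colLen_anti c d hcd.le
      have h2 := (lt_colLen_iff μ i d).2 hd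
      simp only [hookLength]
      omega
    intro c hc d hd hcd
    have hc' := mem_range.1 (mem_coe.1 hc)
    have hd' := mem_range.1 (mem_coe.1 hd)
    rcases lt_trichotomy c d with h | h | h
    · exact absurd hcd (hlt c d h hd').ne'
    · exact h
    · exact absurd hcd (hlt d c h hc').ne
  have hinj2 : Set.InjOn (fun j => shiftedPart μ n i - shiftedPart μ n j)
      (Ioi i : Finset (Fin n)) := by
    intro j hj k hk hjk
    have h1 := shiftedPart_strictAnti (μ := μ) (mem_Ioi.1 (mem_coe.1 hj))
    have h2 := shiftedPart_strictAnti (μ := μ) (mem_Ioi.1 (mem_coe.1 hk))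
    refine (shiftedPart_strictAnti (μ := μ)).injective ?_
    simp only at hjk
    omega
  have hdisj : Disjoint ((range (μ.rowLen i)).image fun c => hookLength μ (i, c))
      ((Ioi i).image fun j => shiftedPart μ n i - shiftedPart μ n j) := by
    rw [disjoint_left]
    intro s hs ht
    obtain ⟨c, hc, rfl⟩ := mem_image.1 hs
    obtain ⟨j, hj, hjc⟩ := mem_image.1 ht
    have hij : (i : ℕ) < j := Fin.lt_def.1 (mem_Ioi.1 hj)
    have h1 := mem_range.1 hc
    have h2 := (lt_colLen_iff μ i c).2 h1
    -- Equality would force `λᵗ_c + λ_j = c + j + 1`. But `j < λᵗ_c` and `c < λ_j` hold together or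
    -- fail together, making the sum at least `c + j + 2` or at most `c + j`.
    have h3 := lt_colLen_iff μ j c
    have h4 := μ.rowLen_anti i j hij.le
    simp only [hookLength, shiftedPart] at hjc
    omega
  refine ⟨eq_of_subset_of_card_le ?_ ?_, hdisj, hinj1, hinj2⟩
  · refine union_subset ?_ ?_
    · intro s hs
      obtain ⟨c, hc, rfl⟩ := mem_image.1 hs
      have h1 := mem_range.1 hc
      have h2 := (lt_colLen_iff μ i c).2 h1
      have h3 := hcol c
      rw [mem_Icc]
      simp only [hookLength, shiftedPart]
      omega
    · intro s hs
      obtain ⟨j, hj, rfl⟩ := mem_image.1 hs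
      have := shiftedPart_strictAnti (μ := μ) (mem_Ioi.1 hj)
      rw [mem_Icc]
      omega
  -- The count is `λ_i + (n-1-i) = h_i`.
  · rw [card_union_of_disjoint hdisj, card_image_of_injOn hinj1, card_image_of_injOn hinj2,
      card_range, Fin.card_Ioi, Nat.card_Icc]
    simp only [shiftedPart]
    omega

lemma prod_row_hooks (hn : μ.colLen 0 ≤ n) (b : ℕ → ℂ) (i : Fin n) :
    (∏ c ∈ range (μ.rowLen i), b (hookLength μ (i, c)))
        * ∏ j ∈ Ioi i, b (shiftedPart μ n i - shiftedPart μ n j)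
      = bFactorial b (shiftedPart μ n i) := by
  obtain ⟨hU, hd, h1, h2⟩ := row_hooks_union hn i
  rw [← prod_image (f := b) h1, ← prod_image (f := b) h2, ← prod_union hd, hU, bFactorial,
    range_eq_Ico, prod_Ico_add' b 0 _ 1, zero_add]
  rfl

lemma prod_cells (hn : μ.colLen 0 ≤ n) (F : ℕ × ℕ → ℂ) :
    ∏ c ∈ μ.cells, F c = ∏ i : Fin n, ∏ c ∈ range (μ.rowLen i), F (i, c) := by
  rw [Fin.prod_univ_eq_prod_range fun i => ∏ c ∈ range (μ.rowLen i), F (i, c)]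
  refine prod_finset_product μ.cells (range n) (fun i => range (μ.rowLen i)) fun p => ?_
  rw [YoungDiagram.mem_cells, mem_range, mem_range, ← YoungDiagram.mem_iff_lt_rowLen]
  refine ⟨fun h => ⟨?_, h⟩, fun h => h.2⟩
  have h1 := YoungDiagram.mem_iff_lt_colLen.1 (show (p.1, p.2) ∈ μ from h)
  exact h1.trans_le ((μ.colLen_anti 0 _ (Nat.zero_le _)).trans hn)

lemma prod_hooks_mul_prod_differences (hn : μ.colLen 0 ≤ n) (b : ℕ → ℂ) :
    (∏ c ∈ μ.cells, b (hookLength μ c))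
        * ∏ i : Fin n, ∏ j ∈ Ioi i, b (shiftedPart μ n i - shiftedPart μ n j)
      = ∏ i, bFactorial b (shiftedPart μ n i) := by
  rw [prod_cells hn fun c => b (hookLength μ c), ← prod_mul_distrib]
  exact prod_congr rfl fun i _ => prod_row_hooks hn b i

lemma prod_Ioi_eq_prod_pow (g : Fin n → ℂ) :
    ∏ i : Fin n, ∏ j ∈ Ioi i, g j = ∏ j, g j ^ (j : ℕ) := by
  rw [prod_comm' (t' := univ) (s' := fun j => Iio j) (by simp)]
  simp

/-- Each difference `b (h_i - h_j)` contributes `u (h_j)`, once for every `i < j`; hence the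
exponent `j`. -/
lemma vdm_div_prod_bFactorial (hn : μ.colLen 0 ≤ n) {b x u : ℕ → ℂ} (hb : ∀ k, b (k + 1) ≠ 0)
    (hx : ∀ s h, s < h → b (h - s) = u s * (x h - x s)) :
    (∏ j : Fin n, u (shiftedPart μ n j) ^ (j : ℕ))
        * (vdm (fun i => x (shiftedPart μ n i)) / ∏ i, bFactorial b (shiftedPart μ n i))
      = 1 / ∏ c ∈ μ.cells, b (hookLength μ c) := by
  have h1 := prod_hooks_mul_prod_differences hn b
  have h2 : ∏ i : Fin n, ∏ j ∈ Ioi i, b (shiftedPart μ n i - shiftedPart μ n j)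
      = (∏ j : Fin n, u (shiftedPart μ n j) ^ (j : ℕ))
        * vdm (fun i => x (shiftedPart μ n i)) := by
    rw [← prod_Ioi_eq_prod_pow, vdm, ← prod_mul_distrib]
    refine prod_congr rfl fun i _ => ?_
    rw [← prod_mul_distrib]
    exact prod_congr rfl fun j hj => hx _ _ (shiftedPart_strictAnti (mem_Ioi.1 hj))
  have h3 : ∏ i, bFactorial b (shiftedPart μ n i) ≠ 0 :=
    prod_ne_zero_iff.2 fun i _ => bFactorial_ne_zero hb _
  have h4 : ∏ c ∈ μ.cells, b (hookLength μ c) ≠ 0 := prod_ne_zero_iff.2 fun c hc => by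
    obtain ⟨k, hk⟩ := Nat.exists_eq_succ_of_ne_zero (hookLength_pos hc).ne'
    rw [hk]
    exact hb k
  rw [h2] at h1
  rw [← mul_div_assoc, div_eq_div_iff h3 h4, one_mul, ← h1]
  ring

/-! ### The quotient for `b(k) = k` and for `b(k) = 1 - q^k`. -/

lemma bFactorial_natCast (k : ℕ) : bFactorial (fun k => (k : ℂ)) k = k.factorial := by
  rw [bFactorial, ← prod_range_add_one_eq_factorial]
  push_cast
  rfl

lemma vdmRatio_eq (hn : μ.colLen 0 ≤ n) : vdmRatio μ n = 1 / (hookProd μ : ℂ) := by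
  have h := vdm_div_prod_bFactorial hn (b := fun k => (k : ℂ)) (x := fun k => (k : ℂ))
    (u := fun _ => 1) (fun k => by exact_mod_cast Nat.succ_ne_zero k)
    (fun s h hs => by push_cast [Nat.cast_sub hs.le]; ring)
  simpa [bFactorial_natCast, vdmRatio, hookProd] using h

lemma bFactorial_one_sub_pow (q : ℂ) (k : ℕ) :
    bFactorial (fun k => 1 - q ^ k) k = qPoch q 1 k := by
  refine prod_congr rfl fun s _ => ?_
  rw [show (1 : ℂ) + s = ((s + 1 : ℕ) : ℂ) by push_cast; ring, Complex.cpow_natCast]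

lemma one_sub_pow_sub {q : ℂ} (hq : q ≠ 0) (s h : ℕ) (hs : s < h) :
    1 - q ^ (h - s) = -(q ^ s)⁻¹ * (q ^ h - q ^ s) := by
  rw [← Nat.sub_add_cancel hs.le, pow_add, Nat.add_sub_cancel]
  field_simp
  ring

lemma prod_neg_inv_pow (q : ℂ) (n : ℕ) :
    ∏ m ∈ range n, ∏ s ∈ range m, -(q ^ s)⁻¹ = (-1) ^ n.choose 2 / q ^ n.choose 3 := by
  have h : ∀ m, ∏ s ∈ range m, -(q ^ s)⁻¹ = (-1) ^ m / q ^ m.choose 2 := by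
    intro m
    rw [prod_neg, card_range, prod_inv_distrib, prod_pow_eq_pow_sum, sum_range_id,
      ← Nat.choose_two_right]
    rfl
  induction n with
  | zero => simp
  | succ n ih =>
    rw [prod_range_succ, ih, h, Nat.choose_succ_succ n 1, Nat.choose_succ_succ n 2,
      Nat.choose_one_right, pow_add, pow_add, div_mul_div_comm]
    ring

/-- Three-element subsets of `{0, …, n-1}` are counted by their middle element `j`. -/
lemma sum_mul_sub_eq_choose_three (n : ℕ) : ∑ j ∈ range n, j * (n - 1 - j) = n.choose 3 := by
  induction n with
  | zero => simp
  | succ n ih =>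
    rw [Nat.choose_succ_succ n 2, ← ih, Nat.choose_two_right, ← sum_range_id, sum_range_succ,
      ← sum_add_distrib]
    simp only [Nat.add_sub_cancel, Nat.sub_self, mul_zero, add_zero]
    refine sum_congr rfl fun j hj => ?_
    have := mem_range.1 hj
    rw [show n - j = 1 + (n - 1 - j) by omega, mul_add, mul_one]

lemma sum_mul_shiftedPart (hn : μ.colLen 0 ≤ n) :
    ∑ j : Fin n, shiftedPart μ n j * (j : ℕ) = nStat μ + n.choose 3 := by
  simp only [shiftedPart]
  rw [Fin.sum_univ_eq_sum_range fun j => (μ.rowLen j + (n - 1 - j)) * j,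
    ← sum_mul_sub_eq_choose_three, nStat,
    sum_subset (range_subset_range.2 hn) (fun i _ hi => by
      rw [rowLen_eq_zero (not_lt.1 fun h => hi (mem_range.2 h)), mul_zero]), ← sum_add_distrib]
  exact sum_congr rfl fun j _ => by ring

lemma qVdmRatio_eq (hn : μ.colLen 0 ≤ n) {q : ℂ} (hq : q ≠ 0) (hq1 : ∀ m : ℕ, 1 ≤ m → q ^ m ≠ 1) :
    (-1) ^ n.choose 2 / q ^ n.choose 3 * qVdmRatio μ n q = q ^ nStat μ / hookPoly μ q := by
  have h := vdm_div_prod_bFactorial hn (b := fun k => 1 - q ^ k) (x := fun k => q ^ k)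
    (u := fun s => -(q ^ s)⁻¹) (fun k => sub_ne_zero.2 (hq1 _ (Nat.le_add_left 1 k)).symm)
    (one_sub_pow_sub hq)
  have hu : ∏ j : Fin n, (-(q ^ shiftedPart μ n j)⁻¹) ^ (j : ℕ)
      = (-1) ^ n.choose 2 / q ^ (nStat μ + n.choose 3) := by
    rw [← sum_mul_shiftedPart hn, ← prod_pow_eq_pow_sum, Nat.choose_two_right, ← sum_range_id,
      ← Fin.sum_univ_eq_sum_range fun j => j, ← prod_pow_eq_pow_sum, ← prod_div_distrib]
    refine prod_congr rfl fun j _ => ?_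
    rw [neg_pow, inv_pow, ← pow_mul]
    rfl
  simp only [bFactorial_one_sub_pow] at h
  rw [hu, ← qVdmRatio, ← hookPoly, pow_add] at h
  rw [← mul_one_div (q ^ nStat μ), ← h]
  field_simp

end Hooks

end SchurSpec

/-! ### Schur functions from the recurrences. -/

namespace SchurSpec

open Finset

lemma elemSchur_eq_factorialRatio {t : ℕ → ℂ} {f : ℤ → ℂ} {b : ℕ → ℂ} (hb : ∀ k, b (k + 1) ≠ 0)
    (h : ∀ k : ℕ, elemSchur t (k + 1 : ℕ) * b (k + 1) = elemSchur t k * f k) (k : ℤ) :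
    elemSchur t k = factorialRatio f b 0 k := by
  rcases lt_or_ge k 0 with hk | hk
  · rw [elemSchur_of_neg t hk, factorialRatio_of_neg _ _ _ hk]
  · lift k to ℕ using hk
    rw [factorialRatio_natCast, eq_div_iff (bFactorial_ne_zero hb k)]
    induction k with
    | zero => simp [bFactorial, elemSchur_zero]
    | succ k ih =>
      rw [bFactorial_succ, prod_range_succ, ← ih, mul_comm (bFactorial b k), ← mul_assoc, h]
      simp only [Nat.cast_zero, sub_zero]
      ring

variable (μ : YoungDiagram)

lemma schur_eq_of_recurrence {t : ℕ → ℂ} {f : ℤ → ℂ} {b c x u : ℕ → ℂ} (hb : ∀ k, b (k + 1) ≠ 0)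
    (ht : ∀ k : ℕ, elemSchur t (k + 1 : ℕ) * b (k + 1) = elemSchur t k * f k)
    (hf : ∀ r k : ℕ, f (k - r) = f (-r - 1) + c r * b (k + 1))
    (hx : ∀ s h, s < h → b (h - s) = u s * (x h - x s)) :
    schur μ t = (∏ i ∈ range (μ.colLen 0), ∏ s ∈ range (μ.rowLen i), f (s - i))
      * ((∏ m ∈ range (μ.colLen 0), ∏ s ∈ range m, u s)
        * vdm (fun i => x (shiftedPart μ (μ.colLen 0) i))
        / ∏ i, bFactorial b (shiftedPart μ (μ.colLen 0) i)) := by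
  rw [← det_factorialRatio_one hb hx, schur]
  simp only [elemSchur_eq_factorialRatio hb ht]
  rw [det_factorialRatio hb hf fun i => μ.rowLen i,
    Fin.prod_univ_eq_prod_range fun i => ∏ s ∈ range (μ.rowLen i), f (s - i)]
  congr 2
  ext i j
  simp only [Matrix.of_apply, shiftedPart]
  congr 1
  omega

lemma schur_tInf : schur μ tInf = 1 / (hookProd μ : ℂ) := by
  rw [schur_eq_of_recurrence μ (f := fun _ => 1) (b := fun k => (k : ℂ)) (c := fun _ => 0)
    (x := fun k => (k : ℂ)) (u := fun _ => 1) (fun k => by exact_mod_cast Nat.succ_ne_zero k)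
    (fun k => by push_cast; simpa using elemSchur_tInf_succ k) (by simp)
    (fun s h hs => by push_cast [Nat.cast_sub hs.le]; ring), ← vdmRatio_eq le_rfl]
  simp [vdmRatio, bFactorial_natCast]

lemma poch_eq_prod (a : ℂ) (m : ℕ) : poch a m = ∏ s ∈ range m, (a + s) := by
  induction m with
  | zero => simp [poch]
  | succ m ih => rw [prod_range_succ, ← ih, poch, poch, ascPochhammer_succ_eval]

lemma schur_tA (a : ℂ) : schur μ (tA a) = pochPartition a μ / (hookProd μ : ℂ) := by
  rw [schur_eq_of_recurrence μ (f := fun s => a + s) (b := fun k => (k : ℂ)) (c := fun _ => 1)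
    (x := fun k => (k : ℂ)) (u := fun _ => 1) (fun k => by exact_mod_cast Nat.succ_ne_zero k)
    (fun k => by push_cast; simpa using elemSchur_tA_succ a k)
    (fun r k => by push_cast; ring)
    (fun s h hs => by push_cast [Nat.cast_sub hs.le]; ring), ← mul_one_div (pochPartition a μ),
    ← vdmRatio_eq le_rfl]
  simp only [bFactorial_natCast, prod_const_one, one_mul, vdmRatio]
  congr 1
  refine prod_congr rfl fun i _ => ?_
  rw [poch_eq_prod]
  refine prod_congr rfl fun s _ => ?_
  push_cast
  ring

/-! ### The product of Gamma ratios and its continuous extension. -/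

variable {μ} {n : ℕ}

lemma gammaRatio_eq (hn : μ.colLen 0 ≤ n) {a : ℂ}
    (ha : ∀ i : Fin n, ∀ k : ℕ, a - (i : ℂ) ≠ -(k : ℂ)) :
    gammaRatio μ n a = pochPartition a μ := by
  rw [gammaRatio, pochPartition, prod_subset (range_subset_range.2 hn) (fun i _ hi => by
      rw [rowLen_eq_zero (not_lt.1 fun h => hi (mem_range.2 h))]; simp [poch]),
    ← Fin.prod_univ_eq_prod_range fun i => poch (a - i) (μ.rowLen i)]
  refine prod_congr rfl fun i _ => ?_
  rw [poch, ← Complex.Gamma_add_nat_div_Gamma_eq _ (ha i)]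
  congr 2
  have : (shiftedPart μ n i : ℂ) + i + 1 = μ.rowLen i + n := by
    have : shiftedPart μ n i + i + 1 = μ.rowLen i + n := by
      unfold shiftedPart
      omega
    exact_mod_cast this
  linear_combination this

lemma schur_tA_eq_gammaRatio (hn : μ.colLen 0 ≤ n) {a : ℂ}
    (ha : ∀ i : Fin n, ∀ k : ℕ, a - (i : ℂ) ≠ -(k : ℂ)) :
    schur μ (tA a) = vdmRatio μ n * gammaRatio μ n a := by
  rw [schur_tA, gammaRatio_eq hn ha, vdmRatio_eq hn]
  ring

lemma continuous_schur_tA : Continuous fun a => schur μ (tA a) := by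
  simp only [schur_tA, pochPartition, poch_eq_prod]
  fun_prop

/-- A punctured neighbourhood of any point contains no integers. -/
lemma eventually_ne_intCast (a : ℂ) : ∀ᶠ b : ℂ in 𝓝[≠] a, ∀ k : ℤ, b ≠ k := by
  have h1 : ((Set.range ((↑) : ℤ → ℂ)) \ {a})ᶜ ∈ 𝓝 a := by
    have hd : IsClosed ((Set.range ((↑) : ℤ → ℂ)) \ {a}) := by
      have := Complex.isClosedEmbedding_intCast.isClosedMap {k : ℤ | (k : ℂ) ≠ a}
        (isClosed_discrete _)
      convert this using 1
      ext z
      simp only [Set.mem_sdiff, Set.mem_range, Set.mem_singleton_iff, Set.mem_image,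
        Set.mem_ofPred_eq]
      constructor
      · rintro ⟨⟨k, rfl⟩, hk⟩
        exact ⟨k, hk, rfl⟩
      · rintro ⟨k, hk, rfl⟩
        exact ⟨⟨k, rfl⟩, hk⟩
    exact hd.isOpen_compl.mem_nhds (by simp)
  filter_upwards [nhdsWithin_le_nhds h1, self_mem_nhdsWithin] with b hb hba k hk
  exact hb ⟨⟨k, hk.symm⟩, hba⟩

lemma tendsto_gammaRatio (hn : μ.colLen 0 ≤ n) (a : ℂ) :
    Tendsto (fun b : ℂ => vdmRatio μ n * gammaRatio μ n b) (𝓝[≠] a) (𝓝 (schur μ (tA a))) := by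
  refine ((continuous_schur_tA.tendsto a).mono_left nhdsWithin_le_nhds).congr' ?_
  filter_upwards [eventually_ne_intCast a] with b hb
  refine schur_tA_eq_gammaRatio hn fun i k h => hb (i - k) ?_
  push_cast
  linear_combination h

/-! ### The `q`-deformed times. -/

lemma one_sub_pow_succ_ne_zero {q : ℂ} (hq1 : ∀ m : ℕ, 1 ≤ m → q ^ m ≠ 1) (k : ℕ) :
    1 - q ^ (k + 1) ≠ 0 :=
  sub_ne_zero.2 (hq1 _ (Nat.le_add_left 1 k)).symm

/-- The free parameter serves both families: `A = 0` for `t(∞, q)` and `A = q^a` for `t(a, q)`. -/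
lemma schur_qTimes {q A : ℂ} (hq : q ≠ 0) (hq1 : ∀ m : ℕ, 1 ≤ m → q ^ m ≠ 1) {t : ℕ → ℂ}
    (ht : ∀ m : ℕ, t (m + 1) * (m + 1) * (1 - q ^ (m + 1)) = 1 - A ^ (m + 1)) :
    schur μ t = (∏ i ∈ range (μ.colLen 0), ∏ s ∈ range (μ.rowLen i), (1 - A * q ^ ((s : ℤ) - i)))
      * (q ^ nStat μ / hookPoly μ q) := by
  rw [schur_eq_of_recurrence μ (f := fun s => 1 - A * q ^ s) (b := fun k => 1 - q ^ k)
    (c := fun r => A * q ^ (-(r : ℤ) - 1)) (x := fun k => q ^ k) (u := fun s => -(q ^ s)⁻¹)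
    (one_sub_pow_succ_ne_zero hq1) (fun k => by simpa using elemSchur_qTimes_succ ht k)
    (fun r k => ?_) (one_sub_pow_sub hq), prod_neg_inv_pow, ← qVdmRatio_eq le_rfl hq hq1]
  · simp only [bFactorial_one_sub_pow, qVdmRatio, mul_div_assoc]
  · have : q ^ ((k : ℤ) - r) = q ^ (-(r : ℤ) - 1) * q ^ (k + 1) := by
      rw [← zpow_natCast, ← zpow_add₀ hq]
      congr 1
      push_cast
      ring
    rw [this]
    ring

lemma tInfQ_mul {q : ℂ} (hq1 : ∀ m : ℕ, 1 ≤ m → q ^ m ≠ 1) (m : ℕ) :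
    tInfQ q (m + 1) * (m + 1) * (1 - q ^ (m + 1)) = 1 - 0 ^ (m + 1) := by
  have h1 := one_sub_pow_succ_ne_zero hq1 m
  have h2 : (m : ℂ) + 1 ≠ 0 := by exact_mod_cast Nat.succ_ne_zero m
  simp only [tInfQ]
  push_cast
  field_simp
  simp

lemma schur_tInfQ_of_ne_zero {q : ℂ} (hq : q ≠ 0) (hq1 : ∀ m : ℕ, 1 ≤ m → q ^ m ≠ 1) :
    schur μ (tInfQ q) = q ^ nStat μ / hookPoly μ q := by
  rw [schur_qTimes hq hq1 (tInfQ_mul hq1)]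
  simp

lemma elemSchur_tInfQ {q : ℂ} (hq1 : ∀ m : ℕ, 1 ≤ m → q ^ m ≠ 1) (k : ℤ) :
    elemSchur (tInfQ q) k = factorialRatio (fun _ => 1) (fun k => 1 - q ^ k) 0 k :=
  elemSchur_eq_factorialRatio (one_sub_pow_succ_ne_zero hq1)
    (fun k => by simpa using elemSchur_qTimes_succ (tInfQ_mul hq1) k) k

lemma schur_tInfQ {q : ℂ} (hq1 : ∀ m : ℕ, 1 ≤ m → q ^ m ≠ 1) :
    schur μ (tInfQ q) = q ^ nStat μ / hookPoly μ q := by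
  rcases eq_or_ne q 0 with rfl | hq
  -- The choice `u_s = -q^{-s}` breaks down at `q = 0`, yet both sides are continuous there: the
  -- entries are `1 / (q; q)_k` or `0`, and every hook is positive.
  · have hball : ∀ᶠ q : ℂ in 𝓝 0, ∀ m : ℕ, 1 ≤ m → q ^ m ≠ 1 := by
      filter_upwards [Metric.ball_mem_nhds (0 : ℂ) one_pos] with q hq m hm h
      have h1 : ‖q‖ ^ m = 1 := by rw [← norm_pow, h, norm_one]
      exact (pow_lt_one₀ (norm_nonneg q) (by simpa using hq) (by omega)).ne h1
    have hL : ContinuousAt (fun q => schur μ (tInfQ q)) 0 := by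
      have hM : ContinuousAt (fun q : ℂ => Matrix.det (Matrix.of fun i j : Fin (μ.colLen 0) =>
          factorialRatio (fun _ => 1) (fun k => 1 - q ^ k) 0
            ((μ.rowLen i : ℤ) - (i : ℤ) + (j : ℤ)))) 0 := by
        simp only [Matrix.det_apply, Matrix.of_apply]
        refine tendsto_finsetSum _ fun σ _ => Tendsto.const_smul
          (tendsto_finsetProd _ fun i _ => ?_) _
        unfold factorialRatio
        split_ifs
        · exact tendsto_const_nhds
        · refine Tendsto.div tendsto_const_nhds ?_
            (bFactorial_ne_zero (one_sub_pow_succ_ne_zero hq1) _)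
          have : Continuous fun q : ℂ => bFactorial (fun k => 1 - q ^ k)
              ((μ.rowLen (σ i) : ℤ) - ((σ i : ℕ) : ℤ) + ((i : ℕ) : ℤ)).toNat := by
            unfold bFactorial
            fun_prop
          exact this.tendsto 0
      refine hM.congr ?_
      filter_upwards [hball] with q hq
      rw [schur]
      simp only [elemSchur_tInfQ hq]
    have hR : ContinuousAt (fun q : ℂ => q ^ nStat μ / hookPoly μ q) 0 := by
      refine ContinuousAt.div (by fun_prop) (by unfold hookPoly; fun_prop) ?_
      refine prod_ne_zero_iff.2 fun c hc => ?_
      rw [zero_pow (hookLength_pos hc).ne']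
      simp
    refine tendsto_nhds_unique (hL.tendsto.mono_left (nhdsWithin_le_nhds (s := {0}ᶜ)))
      ((hR.tendsto.mono_left nhdsWithin_le_nhds).congr' ?_)
    filter_upwards [nhdsWithin_le_nhds hball, self_mem_nhdsWithin] with q hq1 hq
    exact (schur_tInfQ_of_ne_zero hq hq1).symm
  · exact schur_tInfQ_of_ne_zero hq hq1

lemma schur_tAQ {q : ℂ} (hq : q ≠ 0) (hq1 : ∀ m : ℕ, 1 ≤ m → q ^ m ≠ 1) (a : ℂ) :
    schur μ (tAQ a q) = qPochPartition q a μ * (q ^ nStat μ / hookPoly μ q) := by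
  rw [schur_qTimes hq hq1 (A := q ^ a)]
  · congr 1
    refine prod_congr rfl fun i _ => prod_congr rfl fun s _ => ?_
    -- For a fixed nonzero base the principal power is additive in the exponent, so no branch issue
    -- arises.
    rw [show a - i + s = a + ((s - i : ℤ) : ℂ) by push_cast; ring, Complex.cpow_add _ _ hq,
      Complex.cpow_intCast]
  · intro m
    have h1 := one_sub_pow_succ_ne_zero hq1 m
    have h2 : (m : ℂ) + 1 ≠ 0 := by exact_mod_cast Nat.succ_ne_zero m
    simp only [tAQ]
    push_cast
    field_simp

lemma prod_qPoch_eq_qPochPartition (hn : μ.colLen 0 ≤ n) (q a : ℂ) :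
    ∏ i : Fin n, qPoch q (a - (i : ℂ)) (shiftedPart μ n i + (i + 1) - n)
      = qPochPartition q a μ := by
  rw [qPochPartition, prod_subset (range_subset_range.2 hn) (fun i _ hi => by
      rw [rowLen_eq_zero (not_lt.1 fun h => hi (mem_range.2 h))]; simp [qPoch]),
    ← Fin.prod_univ_eq_prod_range fun i => qPoch q (a - i) (μ.rowLen i)]
  refine prod_congr rfl fun i _ => ?_
  -- The natural subtraction is exact: `h_i + (i + 1) - n = λ_i` since `i < n`.
  congr 1
  unfold shiftedPart
  omega

end SchurSpec

theorem lemma1 (μ : YoungDiagram) (n : ℕ) (hn : μ.colLen 0 ≤ n) :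
    -- the times `t_∞`
    (SchurSpec.schur μ SchurSpec.tInf = 1 / (SchurSpec.hookProd μ : ℂ) ∧
      SchurSpec.schur μ SchurSpec.tInf = SchurSpec.vdmRatio μ n) ∧
    -- the times `t(a, 1)`; the product of Gamma ratios is literal where every `Γ(a - i + 1)` is
    -- defined, and is its continuous extension (a polynomial in `a`) at the remaining `a`
    (∀ a : ℂ,
      SchurSpec.schur μ (SchurSpec.tA a)
        = SchurSpec.pochPartition a μ / (SchurSpec.hookProd μ : ℂ) ∧
      ((∀ i : Fin n, ∀ k : ℕ, a - (i : ℂ) ≠ -(k : ℂ)) →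
        SchurSpec.schur μ (SchurSpec.tA a)
          = SchurSpec.vdmRatio μ n * SchurSpec.gammaRatio μ n a) ∧
      Tendsto (fun b : ℂ => SchurSpec.vdmRatio μ n * SchurSpec.gammaRatio μ n b) (𝓝[≠] a)
        (𝓝 (SchurSpec.schur μ (SchurSpec.tA a)))) ∧
    -- the times `t(∞, q)`
    (∀ q : ℂ, (∀ m : ℕ, 1 ≤ m → q ^ m ≠ 1) →
      SchurSpec.schur μ (SchurSpec.tInfQ q)
        = q ^ SchurSpec.nStat μ / SchurSpec.hookPoly μ q ∧
      (q ≠ 0 →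
        SchurSpec.schur μ (SchurSpec.tInfQ q)
          = (-1) ^ n.choose 2 / q ^ n.choose 3 * SchurSpec.qVdmRatio μ n q)) ∧
    -- the times `t(a, q)`
    (∀ q : ℂ, q ≠ 0 → (∀ m : ℕ, 1 ≤ m → q ^ m ≠ 1) → ∀ a : ℂ,
      SchurSpec.schur μ (SchurSpec.tAQ a q)
        = q ^ SchurSpec.nStat μ * SchurSpec.qPochPartition q a μ / SchurSpec.hookPoly μ q ∧
      SchurSpec.schur μ (SchurSpec.tAQ a q)
        = (-1) ^ n.choose 2 / q ^ n.choose 3 * SchurSpec.qVdmRatio μ n q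
          * ∏ i : Fin n,
              SchurSpec.qPoch q (a - (i : ℂ)) (SchurSpec.shiftedPart μ n i + (i + 1) - n)) := by
  refine ⟨⟨SchurSpec.schur_tInf μ, (SchurSpec.schur_tInf μ).trans (SchurSpec.vdmRatio_eq hn).symm⟩,
    fun a => ⟨SchurSpec.schur_tA μ a, SchurSpec.schur_tA_eq_gammaRatio hn,
      SchurSpec.tendsto_gammaRatio hn a⟩,
    fun q hq1 => ⟨SchurSpec.schur_tInfQ hq1, fun hq => ?_⟩, fun q hq hq1 a => ⟨?_, ?_⟩⟩
  · rw [SchurSpec.schur_tInfQ hq1, SchurSpec.qVdmRatio_eq hn hq hq1]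
  · rw [SchurSpec.schur_tAQ hq hq1]
    ring
  · rw [SchurSpec.schur_tAQ hq hq1, SchurSpec.qVdmRatio_eq hn hq hq1,
      SchurSpec.prod_qPoch_eq_qPochPartition hn, mul_comm]
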